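/- Let $p,q\in\mathbb C$ and put $t=pq$. Let $\mathcal O=\mathbb C\{a,b,d,e\}$ be the ring of convergent power series in four variables, and let $(X,0)\subset(\mathbb C^4,0)$ be the germ defined by $$g_1=a^2-2qab+q^2b^2-2bd,\qquad g_2=-2ae+d^2-2pde+p^2e^2,$$ with local ring $\mathcal O_{X,0}=\mathcal O/(g_1,g_2)$. Let $T^1=\mathcal O_{X,0}^2/M'$, where $M'$ is the $\mathcal O_{X,0}$-submodule of $\mathcal O_{X,0}^2$ generated by the four vectors $\left(\frac{\partial g_1}{\partial x},\frac{\partial g_2}{\partial x}\right)$, $x\in\{a,b,d,e\}$. If $t\neq 0$ and $t\neq\frac14$, then the complex vector space $T^1$ has dimension $7$, and the classes of $$(1,0),\ (b,0),\ (e,0),\ (0,1),\ (0,b),\ (0,ae),\ (0,e)$$ form a basis of $T^1$. -/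

import Mathlib

open MvPowerSeries in
/-- A formal power series over `ℂ` in the variables `x₀, …, x_{n-1}` is convergent if it converges
absolutely on some polydisc of positive radius around the origin. -/
def IsConvergentSeries {n : ℕ} (f : MvPowerSeries (Fin n) ℂ) : Prop :=
  ∃ r : ℝ, 0 < r ∧ Summable fun m : Fin n →₀ ℕ => ‖coeff m f‖ * r ^ m.degree

namespace IsConvergentSeries

open MvPowerSeries

variable {n : ℕ} {f g : MvPowerSeries (Fin n) ℂ}

theorem mono {r s : ℝ} (hs : 0 < s) (hsr : s ≤ r)
    (h : Summable fun m : Fin n →₀ ℕ => ‖coeff m f‖ * r ^ m.degree) :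
    Summable fun m : Fin n →₀ ℕ => ‖coeff m f‖ * s ^ m.degree :=
  Summable.of_nonneg_of_le (fun m => by positivity) (fun m => by gcongr) h

theorem add (hf : IsConvergentSeries f) (hg : IsConvergentSeries g) :
    IsConvergentSeries (f + g) := by
  obtain ⟨r, hr, hf⟩ := hf
  obtain ⟨s, hs, hg⟩ := hg
  have ht : 0 < min r s := lt_min hr hs
  refine ⟨min r s, ht, Summable.of_nonneg_of_le (fun m => by positivity) (fun m => ?_)
    ((mono ht (min_le_left r s) hf).add (mono ht (min_le_right r s) hg))⟩
  rw [← add_mul, map_add]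
  gcongr
  exact norm_add_le _ _

theorem mul (hf : IsConvergentSeries f) (hg : IsConvergentSeries g) :
    IsConvergentSeries (f * g) := by
  obtain ⟨r, hr, hf⟩ := hf
  obtain ⟨s, hs, hg⟩ := hg
  have ht : 0 < min r s := lt_min hr hs
  refine ⟨min r s, ht, ?_⟩
  have hf' := mono ht (min_le_left r s) hf
  have hg' := mono ht (min_le_right r s) hg
  generalize min r s = t at *
  have h0 := hf'.mul_of_nonneg hg' (fun m => by positivity) (fun m => by positivity)
  have h := summable_sum_mul_antidiagonal_of_summable_mul
    (f := fun m : Fin n →₀ ℕ => ‖coeff m f‖ * t ^ m.degree)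
    (g := fun m : Fin n →₀ ℕ => ‖coeff m g‖ * t ^ m.degree) h0
  refine Summable.of_nonneg_of_le (fun m => by positivity) (fun m => ?_) h
  rw [coeff_mul, ← le_div_iff₀ (by positivity)]
  refine (norm_sum_le _ _).trans ?_
  rw [le_div_iff₀ (by positivity), Finset.sum_mul]
  refine Finset.sum_le_sum fun x hx => ?_
  rw [← Finset.HasAntidiagonal.mem_antidiagonal.mp hx, map_add, pow_add, norm_mul]
  exact le_of_eq (by ring)

theorem of_finite (h : (Function.support fun m => coeff m f).Finite) :
    IsConvergentSeries f := by
  refine ⟨1, one_pos, summable_of_hasFiniteSupport (h.subset fun m hm => ?_)⟩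
  simp only [Function.mem_support] at hm ⊢
  intro h0
  simp [h0] at hm

theorem C (c : ℂ) : IsConvergentSeries (MvPowerSeries.C c : MvPowerSeries (Fin n) ℂ) := by
  classical
  refine of_finite ((Set.finite_singleton 0).subset fun m hm => ?_)
  by_contra h
  simp_all [coeff_C]

theorem X (i : Fin n) : IsConvergentSeries (MvPowerSeries.X i : MvPowerSeries (Fin n) ℂ) := by
  classical
  refine of_finite ((Set.finite_singleton (Finsupp.single i 1)).subset fun m hm => ?_)
  by_contra h
  simp_all [coeff_X]

theorem pderiv (i : Fin n) (hf : IsConvergentSeries f) :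
    IsConvergentSeries (MvPowerSeries.pderiv ℂ i f) := by
  obtain ⟨r, hr, hf⟩ := hf
  refine ⟨r / 2, by positivity, ?_⟩
  have h := (hf.comp_injective (add_left_injective (Finsupp.single i 1))).mul_right r⁻¹
  refine Summable.of_nonneg_of_le (fun m => by positivity) (fun m => ?_) h
  have h1 : ((m i : ℝ) + 1) ≤ 2 ^ m.degree := by
    have h2 : m i + 1 ≤ 2 ^ m.degree :=
      (Nat.lt_two_pow_self (n := m i)).trans_le
        (Nat.pow_le_pow_right two_pos (Finsupp.le_degree i m))
    exact_mod_cast h2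
  have h3 : ‖((m i : ℂ) + 1)‖ = (m i : ℝ) + 1 := by
    rw [← Nat.cast_succ, Complex.norm_natCast, Nat.cast_succ]
  simp only [Function.comp_apply, coeff_pderiv, norm_mul, h3, map_add, Finsupp.degree_single,
    pow_add, pow_one, div_pow]
  calc _ = ‖coeff (m + Finsupp.single i 1) f‖ * r ^ m.degree * (((m i : ℝ) + 1) / 2 ^ m.degree) := by
        ring
    _ ≤ ‖coeff (m + Finsupp.single i 1) f‖ * r ^ m.degree * 1 := by
        gcongr
        exact (div_le_one (by positivity)).2 h1
    _ = _ := by field_simp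

end IsConvergentSeries

/-- The `ℂ`-algebra `ℂ{x₀, …, x_{n-1}}` of convergent power series, as a subalgebra of the algebra of
formal power series. -/
noncomputable def convergentSubalgebra (n : ℕ) : Subalgebra ℂ (MvPowerSeries (Fin n) ℂ) where
  carrier := {f | IsConvergentSeries f}
  mul_mem' := IsConvergentSeries.mul
  add_mem' := IsConvergentSeries.add
  algebraMap_mem' c := IsConvergentSeries.C c

/-- The ring `ℂ{x₀, …, x_{n-1}}` of convergent power series. -/
abbrev ConvSeries (n : ℕ) : Type := convergentSubalgebra n

namespace ConvSeries

/-- The coordinate function `x_i`. -/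
noncomputable def X {n : ℕ} (i : Fin n) : ConvSeries n :=
  ⟨MvPowerSeries.X i, IsConvergentSeries.X i⟩

/-- The partial derivative `∂f/∂x_i` of a convergent power series. -/
noncomputable def pderiv {n : ℕ} (i : Fin n) (f : ConvSeries n) : ConvSeries n :=
  ⟨MvPowerSeries.pderiv ℂ i f.1, IsConvergentSeries.pderiv i f.2⟩

end ConvSeries

namespace SpaceGerm

variable {n k : ℕ}

/-- The local ring `𝒪_{X,0} = ℂ{x₀, …, x_{n-1}} / (g₀, …, g_{k-1})` of the germ `(X, 0)` in `(ℂⁿ, 0)`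
defined by the equations `g₀ = ⋯ = g_{k-1} = 0`. -/
abbrev LocalRing (g : Fin k → ConvSeries n) : Type :=
  ConvSeries n ⧸ Ideal.span (Set.range g)

/-- The `𝒪_{X,0}`-submodule of `𝒪_{X,0}ᵏ` generated by the `n` vectors
`(∂g₀/∂x_j, …, ∂g_{k-1}/∂x_j)`. -/
noncomputable def jacobianSubmodule (g : Fin k → ConvSeries n) :
    Submodule (LocalRing g) (Fin k → LocalRing g) :=
  Submodule.span (LocalRing g) (Set.range fun (j : Fin n) (i : Fin k) =>
    Ideal.Quotient.mk (Ideal.span (Set.range g)) (ConvSeries.pderiv j (g i)))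

/-- The space `T¹ = 𝒪_{X,0}ᵏ / M'`, where `M'` is generated by the vectors of partial derivatives of
the defining equations. -/
abbrev T1 (g : Fin k → ConvSeries n) : Type :=
  (Fin k → LocalRing g) ⧸ jacobianSubmodule g

/-- The class in `T¹` of a vector of convergent power series. -/
noncomputable def T1.mk (g : Fin k → ConvSeries n) (v : Fin k → ConvSeries n) : T1 g :=
  Submodule.Quotient.mk fun i => Ideal.Quotient.mk (Ideal.span (Set.range g)) (v i)

end SpaceGerm

namespace SliceGerm

/-- The coordinate `a` on `ℂ⁴`. -/
noncomputable def a : ConvSeries 4 := ConvSeries.X 0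

/-- The coordinate `b` on `ℂ⁴`. -/
noncomputable def b : ConvSeries 4 := ConvSeries.X 1

/-- The coordinate `d` on `ℂ⁴`. -/
noncomputable def d : ConvSeries 4 := ConvSeries.X 2

/-- The coordinate `e` on `ℂ⁴`. -/
noncomputable def e : ConvSeries 4 := ConvSeries.X 3

/-- The pair `(g₁, g₂)` of equations of the germ, depending on the parameters `p` and `q`. -/
noncomputable def equations (p q : ℂ) : Fin 2 → ConvSeries 4 :=
  ![a ^ 2 - (2 * q) • (a * b) + (q ^ 2) • b ^ 2 - (2 : ℂ) • (b * d),
    -((2 : ℂ) • (a * e)) + d ^ 2 - (2 * p) • (d * e) + (p ^ 2) • e ^ 2]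

end SliceGerm

/-! Write E = (1,0), F = (0,1). The Jacobian columns say aE = qbE + eF, dE = -qeF, dF = bE + peF, aF
= -pbE, so bE, eE, bF, eF span degree one of T¹. Together with g₁ and g₂ they make every quadratic
monomial times E or F a multiple of s = beE (`quadratic_relations`). In degree three everything
reduces to es, and (1 - 4t)es = 0, so the variables kill s (`cubic_relations`). The seven classes
are thus those of degree at most one, plus aeF = -ps.

To pass from monomials to power series without a topology on T¹, `smul_add_smul_mem_span` descends
from s through the lower degrees: an element of the span W all of whose multiples by variables lie
in the core of W is itself in the core.

For independence, a relation in T¹ is lifted to an identity of power series, whose Taylor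
coefficients of order at most two at 0 are compared. Functionals dual to the classes, vanishing on
M' and on multiples of the gᵢ, isolate each coefficient (`coefficients_eq_zero`). The condition t ≠
1/4 enters only through spanning. -/

/-! ### Splitting a power series along its variables -/

namespace ConvSeries

open MvPowerSeries

variable {n : ℕ}

/-- The part of `f` consisting of the monomials whose first variable is `x_i`, divided by `x_i`. -/
noncomputable def divX (i : Fin n) (f : ConvSeries n) : ConvSeries n :=
  ⟨fun m => if ∀ j < i, m j = 0 then coeff (m + Finsupp.single i 1) f.1 else 0, by
    obtain ⟨r, hr, hf⟩ := f.2
    refine ⟨r, hr, ?_⟩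
    have h := (hf.comp_injective (add_left_injective (Finsupp.single i 1))).mul_right r⁻¹
    refine Summable.of_nonneg_of_le (fun m => by positivity) (fun m => ?_) h
    simp only [Function.comp_apply, map_add, Finsupp.degree_single, pow_add, pow_one]
    rw [← mul_assoc, mul_inv_cancel_right₀ hr.ne']
    gcongr
    change ‖ite _ _ _‖ ≤ _
    split_ifs
    · exact le_rfl
    · simp⟩

theorem coeff_X_mul_divX (i : Fin n) (f : ConvSeries n) (m : Fin n →₀ ℕ) :
    coeff m (MvPowerSeries.X i * (divX i f).1) =
      if m i ≠ 0 ∧ ∀ j < i, m j = 0 then coeff m f.1 else 0 := by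
  classical
  have hdiv (k : Fin n →₀ ℕ) : coeff k (divX i f).1 =
      if ∀ j < i, k j = 0 then coeff (k + Finsupp.single i 1) f.1 else 0 := rfl
  rw [MvPowerSeries.X, coeff_monomial_mul, one_mul, hdiv]
  by_cases hi : 1 ≤ m i
  · have hle : Finsupp.single i 1 ≤ m := Finsupp.single_le_iff.2 hi
    have hiff : (∀ j < i, (m - (Finsupp.single i 1 : Fin n →₀ ℕ)) j = 0) ↔ ∀ j < i, m j = 0 := by
      refine forall₂_congr fun j hj => ?_
      simp [hj.ne']
    simp only [hiff, tsub_add_cancel_of_le hle, hle, if_true]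
    simp [Nat.one_le_iff_ne_zero.1 hi]
  · have h0 : m i = 0 := by omega
    simp [h0]

/-- Every convergent power series is the sum of a constant and of multiples of the variables. -/
theorem eq_algebraMap_add_sum (f : ConvSeries n) :
    f = algebraMap ℂ (ConvSeries n) (constantCoeff f.1) + ∑ i, X i * divX i f := by
  classical
  apply Subtype.ext
  ext m
  have hs : ((algebraMap ℂ (ConvSeries n) (constantCoeff f.1) + ∑ i, X i * divX i f :
      ConvSeries n) : MvPowerSeries (Fin n) ℂ) =
      MvPowerSeries.C (constantCoeff f.1) + ∑ i, MvPowerSeries.X i * (divX i f).1 := by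
    rw [Subalgebra.coe_add, Subalgebra.coe_algebraMap, AddSubmonoidClass.coe_finsetSum]
    rfl
  rw [hs, map_add, map_sum, coeff_C]
  simp only [coeff_X_mul_divX]
  by_cases hm : m = 0
  · subst hm
    simp
  · have hne : ∃ i, m i ≠ 0 := by
      by_contra! h
      exact hm (Finsupp.ext h)
    -- A nonconstant monomial is produced exactly once, by the term of the first variable occurring
    -- in it.
    obtain ⟨i, hi, hmin⟩ := (Finset.univ.filter fun i => m i ≠ 0).exists_minimal
      (by obtain ⟨i, hi⟩ := hne; exact ⟨i, by simpa using hi⟩)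
    simp only [Finset.mem_filter, Finset.mem_univ, true_and] at hi hmin
    have hlt : ∀ j < i, m j = 0 := fun j hj => by
      by_contra h
      exact absurd (hmin h hj.le) (not_le.2 hj)
    rw [Finset.sum_eq_single i, if_neg hm, if_pos ⟨hi, hlt⟩, zero_add]
    · intro k _ hk
      refine if_neg fun h => ?_
      rcases lt_or_gt_of_ne hk with hki | hik
      · exact h.1 (hlt k hki)
      · exact hi (h.2 i hik)
    · simp

end ConvSeries

/-! ### Relations of degree two and three -/

section Relations

variable {R T : Type*} [CommRing R] [AddCommGroup T] [Module R T]
  {p q p' q' a b d e : R} {E F : T}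

/-- The degree two consequences of the relations between the two generators of `T¹`. -/
theorem quadratic_relations (hp : p * p' = 1) (hq : q * q' = 1)
    (haE : a • E = q • b • E + e • F) (hdE : d • E = -q • e • F)
    (hdF : d • F = b • E + p • e • F) (haF : a • F = -p • b • E)
    (g1E : (a ^ 2 - 2 * q * (a * b) + q ^ 2 * b ^ 2 - 2 * (b * d)) • E = 0)
    (g1F : (a ^ 2 - 2 * q * (a * b) + q ^ 2 * b ^ 2 - 2 * (b * d)) • F = 0)
    (g2E : (-(2 * (a * e)) + d ^ 2 - 2 * p * (d * e) + p ^ 2 * e ^ 2) • E = 0) :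
    b • e • F = (p * q') • b • e • E ∧
    e • e • F = (-(1 - 2 * p * q) * p') • b • e • E ∧
    b • b • E = (-(1 - 2 * p * q) * p * q' ^ 2) • b • e • E ∧
    q ^ 2 • b • b • F = (2 - p * q) • b • b • E + (3 * p) • b • e • F ∧
    p ^ 2 • e • e • E = (3 * q) • b • e • E + (2 - p * q) • e • e • F := by
  have hp' (x : T) : p • p' • x = x := by rw [smul_smul, hp, one_smul]
  have hq' (x : T) : q • q' • x = x := by rw [smul_smul, hq, one_smul]
  -- Here g₁E = (a - qb)²E - 2bdE, and (a - qb)E = eF turns it into qbeF - pbeE.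
  have r : p • b • e • E = q • b • e • F := by
    linear_combination (norm := module) -g1E + (a - q * b) • haE + e • haF - (2 * b) • hdE
  have beF : b • e • F = (p * q') • b • e • E := by
    linear_combination (norm := module) -q' • r - hq' (b • e • F)
  refine ⟨beF, ?_, ?_, ?_, ?_⟩
  -- Computing adE in two ways gives eeF, and adF in two ways gives bbE; the last two formulas
  -- expand g₁F = 0 and g₂E = 0.
  · linear_combination (norm := module) p' • (a • hdE - d • haE - (q * b) • hdE - e • hdF
      - (q * e) • haF - q • r) - hp' (e • e • F)
  · linear_combination (norm := module) q' • (d • haF - a • hdF - (p * b) • hdE - b • haE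
      - (p * e) • haF + p • r) - hq' (b • b • E) - (q' * (1 - 2 * p * q)) • beF
  · linear_combination (norm := module) g1F - a • haF + (p * b) • haE + (2 * q * b) • haF
      + (2 * b) • hdF
  · linear_combination (norm := module) g2E - d • hdE + (q * e) • hdF + (2 * e) • haE
      + (2 * p * e) • hdE

/-- The degree three consequences of the relations between the two generators of `T¹`. -/
theorem cubic_relations {w : R} (hp : p * p' = 1) (hq : q * q' = 1)
    (hw : (4 * p * q - 1) * w = 1)
    (haE : a • E = q • b • E + e • F) (hdE : d • E = -q • e • F)
    (beF : b • e • F = (p * q') • b • e • E)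
    (bbE : b • b • E = (-(1 - 2 * p * q) * p * q' ^ 2) • b • e • E)
    (eeE : p ^ 2 • e • e • E = (3 * q) • b • e • E + (2 - p * q) • e • e • F) :
    a • b • e • E = 0 ∧ b • b • e • E = 0 ∧ d • b • e • E = 0 ∧ e • b • e • E = 0 := by
  have hp' (x : T) : p • p' • x = x := by rw [smul_smul, hp, one_smul]
  have hq' (x : T) : q • q' • x = x := by rw [smul_smul, hq, one_smul]
  have hw' (x : T) : (4 * p * q - 1) • w • x = x := by rw [smul_smul, hw, one_smul]
  have y : b • b • e • E = (-(1 - 2 * p * q) * p * q' ^ 2) • e • b • e • E := by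
    linear_combination (norm := module) e • bbE
  have x1 : (p ^ 2) • e • b • e • E = 
      (3 * q * (-(1 - 2 * p * q) * p * q' ^ 2) + (2 - p * q) * (p * q')) • e • b • e • E := by
    linear_combination (norm := module) b • eeE + (3 * q) • y + ((2 - p * q) * e) • beF
  -- Multiplying `x1` by q/p turns its two scalars into t and 5t - 1, whose difference is 1 - 4t.
  have x2 : (4 * p * q - 1) • e • b • e • E = 0 := by
    have h1 : p' * (q * (p ^ 2 -
        (3 * q * (-(1 - 2 * p * q) * p * q' ^ 2) + (2 - p * q) * (p * q')))) =
        -(4 * p * q - 1) := by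
      calc _ = p * q * (p * p') + 3 * (1 - 2 * p * q) * (p * p') * (q * q') ^ 2
            - (2 - p * q) * (p * p') * (q * q') := by ring
        _ = _ := by rw [hp, hq]; ring
    have h2 : (p' * (q * (p ^ 2 - (3 * q * (-(1 - 2 * p * q) * p * q' ^ 2)
        + (2 - p * q) * (p * q'))))) • e • b • e • E = 0 := by
      linear_combination (norm := module) (p' * q) • x1
    rw [h1, neg_smul, neg_eq_zero] at h2
    exact h2
  have x : e • b • e • E = 0 := by
    linear_combination (norm := module) w • x2 - hw' (e • b • e • E)
  have y0 : b • b • e • E = 0 := by rw [y, x, smul_zero]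
  refine ⟨?_, y0, ?_, x⟩
  · linear_combination (norm := module) (b * e) • haE + q • y0 + e • beF
      + (p * q') • x
  · linear_combination (norm := module) (b * e) • hdE - (q * e) • beF - (q * p * q') • x

end Relations

/-! ### Spanning by descent on the degree -/

section Span

variable {R T : Type*} [CommRing R] [Algebra ℂ R] [AddCommGroup T] [Module R T] [Module ℂ T]
  [IsScalarTower ℂ R T] {n : ℕ} {x : Fin n → R}

/-- The largest `R`-submodule contained in a complex subspace. -/
def Submodule.core (R : Type*) {T : Type*} [CommRing R] [AddCommGroup T] [Module R T] [Module ℂ T]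
    [SMulCommClass R ℂ T] (W : Submodule ℂ T) : Submodule R T where
  carrier := {v | ∀ f : R, f • v ∈ W}
  zero_mem' f := by simp
  add_mem' hv hw f := by
    rw [smul_add]
    exact W.add_mem (hv f) (hw f)
  smul_mem' g v hv f := by
    rw [← mul_smul]
    exact hv (f * g)

/-- If every ring element is a constant plus a combination of the `x i`, then an element `v` of a
complex subspace `W` lies in the core of `W` once all `x i • v` do. -/
theorem mem_core_of_smul_var_mem_core
    (hR : ∀ f : R, ∃ (c : ℂ) (f' : Fin n → R), f = algebraMap ℂ R c + ∑ i, x i * f' i)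
    {W : Submodule ℂ T} {v : T} (hv : v ∈ W) (h : ∀ i, x i • v ∈ W.core R) : v ∈ W.core R := by
  intro f
  obtain ⟨c, f', rfl⟩ := hR f
  rw [add_smul, algebraMap_smul, Finset.sum_smul]
  refine W.add_mem (W.smul_mem c hv) (W.sum_mem fun i _ => ?_)
  rw [mul_comm, mul_smul]
  exact h i (f' i)

/-- A module generated by `E` and `F` with the relations of `T¹` is spanned over `ℂ` by seven
explicit elements. -/
theorem smul_add_smul_mem_span {p q : ℂ} (h0 : p * q ≠ 0) (h1 : p * q ≠ 1 / 4)
    {a b d e : R} {E F : T}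
    (hR : ∀ f : R, ∃ (c : ℂ) (f' : Fin 4 → R), f = algebraMap ℂ R c + ∑ i, ![a, b, d, e] i * f' i)
    (haE : a • E = q • b • E + e • F) (hdE : d • E = -q • e • F)
    (hdF : d • F = b • E + p • e • F) (haF : a • F = -p • b • E)
    (g1E : (a ^ 2 - (2 * q) • (a * b) + q ^ 2 • b ^ 2 - (2 : ℂ) • (b * d)) • E = 0)
    (g1F : (a ^ 2 - (2 * q) • (a * b) + q ^ 2 • b ^ 2 - (2 : ℂ) • (b * d)) • F = 0)
    (g2E : (-((2 : ℂ) • (a * e)) + d ^ 2 - (2 * p) • (d * e) + p ^ 2 • e ^ 2) • E = 0)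
    (f g : R) :
    f • E + g • F ∈ Submodule.span ℂ (Set.range ![E, b • E, e • E, F, b • F, (a * e) • F, e • F]) := by
  set W := Submodule.span ℂ (Set.range ![E, b • E, e • E, F, b • F, (a * e) • F, e • F]) with hW
  have hmem (i) : ![E, b • E, e • E, F, b • F, (a * e) • F, e • F] i ∈ W :=
    Submodule.subset_span ⟨i, rfl⟩
  have hp0 : p ≠ 0 := left_ne_zero_of_mul h0
  have hq0 : q ≠ 0 := right_ne_zero_of_mul h0
  have hw0 : 4 * p * q - 1 ≠ 0 := fun h => h1 (by linear_combination h / 4)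
  have hp : algebraMap ℂ R p * algebraMap ℂ R p⁻¹ = 1 := by
    rw [← map_mul, mul_inv_cancel₀ hp0, map_one]
  have hq : algebraMap ℂ R q * algebraMap ℂ R q⁻¹ = 1 := by
    rw [← map_mul, mul_inv_cancel₀ hq0, map_one]
  have hw : (4 * algebraMap ℂ R p * algebraMap ℂ R q - 1) * algebraMap ℂ R (4 * p * q - 1)⁻¹ = 1 := by
    have h : 4 * algebraMap ℂ R p * algebraMap ℂ R q - 1 = algebraMap ℂ R (4 * p * q - 1) := by
      rw [map_sub, map_mul, map_mul, map_ofNat, map_one]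
    rw [h, ← map_mul, mul_inv_cancel₀ hw0, map_one]
  have hs (z : ℂ) (v : T) : z • v = algebraMap ℂ R z • v := (algebraMap_smul R z v).symm
  have haE' : a • E = algebraMap ℂ R q • b • E + e • F := by rw [haE, hs]
  have hdE' : d • E = -algebraMap ℂ R q • e • F := by rw [hdE, hs, map_neg]
  have hdF' : d • F = b • E + algebraMap ℂ R p • e • F := by rw [hdF, hs]
  have haF' : a • F = -algebraMap ℂ R p • b • E := by rw [haF, hs, map_neg]
  simp only [Algebra.smul_def, map_mul, map_pow, map_ofNat] at g1E g1F g2E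
  obtain ⟨beF, eeF, bbE, bbF, eeE⟩ := quadratic_relations hp hq haE' hdE' hdF' haF' g1E g1F g2E
  obtain ⟨as, bs, ds, es⟩ := cubic_relations hp hq hw haE' hdE' beF bbE eeE
  set s := b • e • E with hsdef
  have hsW : s ∈ W := by
    -- The relation aF = -pbE multiplied by e: this is how (0, ae) represents degree two.
    have h : s = -(p⁻¹ • (a * e) • F) := by
      rw [mul_comm, mul_smul, haF, smul_comm e, neg_smul, smul_neg, smul_smul, inv_mul_cancel₀ hp0,
        one_smul, neg_neg, smul_comm e]
    rw [h]
    exact W.neg_mem (W.smul_mem _ (hmem 5))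
  have hx {v : T} (hv : v ∈ W) (ha : a • v ∈ W.core R) (hb : b • v ∈ W.core R)
      (hd : d • v ∈ W.core R) (he : e • v ∈ W.core R) : v ∈ W.core R :=
    mem_core_of_smul_var_mem_core hR hv fun i => by fin_cases i <;> assumption
  -- All variables kill s, which starts the descent. Degree two follows from multiples of s, then
  -- degree one, then E and F.
  have hS : s ∈ W.core R := hx hsW (by simp [as]) (by simp [bs]) (by simp [ds]) (by simp [es])
  have beF_mem : b • e • F ∈ W.core R := by
    rw [beF]
    exact Submodule.smul_mem _ _ hS
  have eeF_mem : e • e • F ∈ W.core R := by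
    rw [eeF]
    exact Submodule.smul_mem _ _ hS
  have bbE_mem : b • b • E ∈ W.core R := by
    rw [bbE]
    exact Submodule.smul_mem _ _ hS
  have of_pow_smul {z z' : R} (hz : z * z' = 1) {v : T} (hv : z ^ 2 • v ∈ W.core R) :
      v ∈ W.core R := by
    have h : v = z' ^ 2 • z ^ 2 • v := by
      rw [smul_smul, ← mul_pow, mul_comm z', hz, one_pow, one_smul]
    rw [h]
    exact Submodule.smul_mem _ _ hv
  have bbF_mem : b • b • F ∈ W.core R := of_pow_smul hq (by
    rw [bbF]
    exact Submodule.add_mem _ (Submodule.smul_mem _ _ bbE_mem) (Submodule.smul_mem _ _ beF_mem))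
  have eeE_mem : e • e • E ∈ W.core R := of_pow_smul hp (by
    rw [eeE]
    exact Submodule.add_mem _ (Submodule.smul_mem _ _ hS) (Submodule.smul_mem _ _ eeF_mem))
  have hbE : b • E ∈ W.core R := by
    refine hx (hmem 1) ?_ bbE_mem ?_ ?_
    · rw [smul_comm, haE', smul_add, smul_comm b]
      exact Submodule.add_mem _ (Submodule.smul_mem _ _ bbE_mem) beF_mem
    · rw [smul_comm, hdE', smul_comm b]
      exact Submodule.smul_mem _ _ beF_mem
    · rwa [smul_comm]
  have heF : e • F ∈ W.core R := by
    refine hx (hmem 6) ?_ beF_mem ?_ eeF_mem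
    · rw [smul_comm, haF', smul_comm e, smul_comm e]
      exact Submodule.smul_mem _ _ hS
    · rw [smul_comm, hdF', smul_add, smul_comm e, smul_comm e]
      exact Submodule.add_mem _ hS (Submodule.smul_mem _ _ eeF_mem)
  have heE : e • E ∈ W.core R := by
    refine hx (hmem 2) ?_ hS ?_ eeE_mem
    · rw [smul_comm, haE', smul_add]
      exact Submodule.add_mem _ (Submodule.smul_mem _ _ (Submodule.smul_mem _ _ hbE))
        (Submodule.smul_mem _ _ heF)
    · rw [smul_comm, hdE']
      exact Submodule.smul_mem _ _ (Submodule.smul_mem _ _ heF)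
  have hbF : b • F ∈ W.core R := by
    refine hx (hmem 4) ?_ bbF_mem ?_ ?_
    · rw [smul_comm, haF']
      exact Submodule.smul_mem _ _ (Submodule.smul_mem _ _ hbE)
    · rw [smul_comm, hdF', smul_add]
      exact Submodule.add_mem _ bbE_mem (Submodule.smul_mem _ _ (Submodule.smul_mem _ _ heF))
    · rwa [smul_comm]
  have hE : E ∈ W.core R := by
    refine hx (hmem 0) ?_ hbE ?_ heE
    · rw [haE']
      exact Submodule.add_mem _ (Submodule.smul_mem _ _ hbE) heF
    · rw [hdE']
      exact Submodule.smul_mem _ _ heF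
  have hF : F ∈ W.core R := by
    refine hx (hmem 3) ?_ hbF ?_ heF
    · rw [haF']
      exact Submodule.smul_mem _ _ hbE
    · rw [hdF']
      exact Submodule.add_mem _ hbE (Submodule.smul_mem _ _ heF)
  exact W.add_mem (hE f) (hF g)

end Span

/-! ### Derivations, evaluation at the origin, and classes in T¹ -/

namespace ConvSeries

variable {n : ℕ}

/-- Partial differentiation of convergent power series, as a derivation. -/
noncomputable def derivation (i : Fin n) : Derivation ℂ (ConvSeries n) (ConvSeries n) :=
  Derivation.mk'
    { toFun := pderiv i
      map_add' := fun f g => Subtype.ext (map_add (MvPowerSeries.pderiv ℂ i) f.1 g.1)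
      map_smul' := fun c f => Subtype.ext ((MvPowerSeries.pderiv ℂ i).map_smul c f.1) }
    fun f g => Subtype.ext ((MvPowerSeries.pderiv ℂ i).leibniz f.1 g.1)

theorem pderiv_eq_derivation (i : Fin n) (f : ConvSeries n) : pderiv i f = derivation i f := rfl

theorem derivation_X (i j : Fin n) : derivation i (X j) = if j = i then 1 else 0 := by
  apply Subtype.ext
  refine (MvPowerSeries.pderiv_X i j).trans ?_
  rw [Pi.single_apply]
  split_ifs <;> rfl

/-- The value of a convergent power series at the origin. -/
noncomputable def eval₀ : ConvSeries n →ₐ[ℂ] ℂ where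
  toRingHom := MvPowerSeries.constantCoeff.comp (convergentSubalgebra n).val.toRingHom
  commutes' c := MvPowerSeries.constantCoeff_C (σ := Fin n) c

theorem eval₀_X (i : Fin n) : eval₀ (X i) = 0 :=
  MvPowerSeries.constantCoeff_X (R := ℂ) i

end ConvSeries

namespace SpaceGerm

variable {n k : ℕ}

/-- The class map from vectors of convergent power series to `T¹`, as a linear map. -/
noncomputable def T1.mkₗ (g : Fin k → ConvSeries n) : (Fin k → ConvSeries n) →ₗ[ℂ] T1 g where
  toFun := T1.mk g
  map_add' _ _ := rfl
  map_smul' _ _ := rfl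

/-- Lifts a relation to the power series ring, where it can be differentiated; partial derivatives
need not descend to the quotient by the equations. -/
theorem T1.mk_eq_zero_iff {g : Fin k → ConvSeries n} {v : Fin k → ConvSeries n} :
    T1.mk g v = 0 ↔ ∃ (f : Fin n → ConvSeries n) (h : Fin k → Fin k → ConvSeries n),
      ∀ i, v i = ∑ j, f j * ConvSeries.pderiv j (g i) + ∑ l, h i l * g l := by
  rw [T1.mk, Submodule.Quotient.mk_eq_zero, jacobianSubmodule,
    Submodule.mem_span_range_iff_exists_fun]
  constructor
  · rintro ⟨c, hc⟩
    choose f hf using fun j => Ideal.Quotient.mk_surjective (c j)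
    have hmem (i : Fin k) :
        v i - ∑ j, f j * ConvSeries.pderiv j (g i) ∈ Ideal.span (Set.range g) := by
      rw [← Ideal.Quotient.eq_zero_iff_mem, map_sub, map_sum, ← congrFun hc i, Finset.sum_apply,
        sub_eq_zero]
      simp [hf]
    choose h hh using fun i => (Ideal.mem_span_range_iff_exists_fun).1 (hmem i)
    exact ⟨f, h, fun i => by rw [hh i]; ring⟩
  · rintro ⟨f, h, hv⟩
    refine ⟨fun j => Ideal.Quotient.mk _ (f j), funext fun i => ?_⟩
    have hmem : ∑ l, h i l * g l ∈ Ideal.span (Set.range g) :=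
      (Ideal.mem_span_range_iff_exists_fun).2 ⟨h i, rfl⟩
    rw [hv, map_add, Ideal.Quotient.eq_zero_iff_mem.2 hmem, add_zero, map_sum, Finset.sum_apply]
    simp

theorem T1.mk_eq (g : Fin 2 → ConvSeries n) (v : Fin 2 → ConvSeries n) :
    T1.mk g v = Ideal.Quotient.mk (Ideal.span (Set.range g)) (v 0) • T1.mk g ![1, 0] +
      Ideal.Quotient.mk (Ideal.span (Set.range g)) (v 1) • T1.mk g ![0, 1] := by
  simp only [T1.mk, ← Submodule.Quotient.mk_smul, ← Submodule.Quotient.mk_add]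
  congr 1
  ext i
  fin_cases i <;> simp

theorem T1.mk_left (g : Fin 2 → ConvSeries n) (f : ConvSeries n) : T1.mk g ![f, 0] =
    Ideal.Quotient.mk (Ideal.span (Set.range g)) f • T1.mk g ![1, 0] := by
  simp only [T1.mk, ← Submodule.Quotient.mk_smul]
  congr 1
  ext i
  fin_cases i <;> simp

theorem T1.mk_right (g : Fin 2 → ConvSeries n) (f : ConvSeries n) : T1.mk g ![0, f] =
    Ideal.Quotient.mk (Ideal.span (Set.range g)) f • T1.mk g ![0, 1] := by
  simp only [T1.mk, ← Submodule.Quotient.mk_smul]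
  congr 1
  ext i
  fin_cases i <;> simp

theorem T1.mk_surjective (g : Fin k → ConvSeries n) : Function.Surjective (T1.mk g) := by
  intro x
  obtain ⟨y, rfl⟩ := Submodule.Quotient.mk_surjective _ x
  choose v hv using fun i => Ideal.Quotient.mk_surjective (y i)
  exact ⟨v, congrArg _ (funext hv)⟩

theorem T1.jacobian_relation (g : Fin 2 → ConvSeries n) (j : Fin n) :
    Ideal.Quotient.mk (Ideal.span (Set.range g)) (ConvSeries.pderiv j (g 0)) • T1.mk g ![1, 0] +
      Ideal.Quotient.mk (Ideal.span (Set.range g)) (ConvSeries.pderiv j (g 1)) •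
        T1.mk g ![0, 1] = 0 := by
  have hz : T1.mk g (fun i => ConvSeries.pderiv j (g i)) = 0 :=
    T1.mk_eq_zero_iff.2 ⟨Pi.single j 1, 0, fun i => by simp [Pi.single_apply]⟩
  rw [← hz, T1.mk_eq g fun i => ConvSeries.pderiv j (g i)]

end SpaceGerm

/-! ### The Jacobian relations of the germ -/

namespace SliceGerm

open ConvSeries SpaceGerm

theorem derivation_first_equation {R : Type*} [CommRing R] [Algebra ℂ R] (D : Derivation ℂ R R)
    (q : ℂ) (a b d : R) :
    D (a ^ 2 - (2 * q) • (a * b) + (q ^ 2) • b ^ 2 - (2 : ℂ) • (b * d)) =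
      D a * ((2 : ℂ) • a - (2 * q) • b) + D b * (-((2 * q) • a) + (2 * q ^ 2) • b - (2 : ℂ) • d) -
        D d * ((2 : ℂ) • b) := by
  simp only [pow_two a, pow_two b, map_sub, map_add, Derivation.map_smul, Derivation.leibniz,
    smul_eq_mul]
  simp only [Algebra.smul_def, map_mul, map_pow, map_ofNat]
  ring

theorem derivation_second_equation {R : Type*} [CommRing R] [Algebra ℂ R] (D : Derivation ℂ R R)
    (p : ℂ) (a d e : R) :
    D (-((2 : ℂ) • (a * e)) + d ^ 2 - (2 * p) • (d * e) + (p ^ 2) • e ^ 2) =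
      -(D a * ((2 : ℂ) • e)) + D d * ((2 : ℂ) • d - (2 * p) • e) +
        D e * (-((2 : ℂ) • a) - (2 * p) • d + (2 * p ^ 2) • e) := by
  simp only [pow_two d, pow_two e, map_sub, map_add, map_neg, Derivation.map_smul,
    Derivation.leibniz, smul_eq_mul]
  simp only [Algebra.smul_def, map_mul, map_pow, map_ofNat]
  ring

theorem pderiv_first_equation (p q : ℂ) (j : Fin 4) :
    pderiv j (equations p q 0) =
      (![(2 : ℂ) • a - (2 * q) • b, -((2 * q) • a) + (2 * q ^ 2) • b - (2 : ℂ) • d,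
        -((2 : ℂ) • b), 0] : Fin 4 → ConvSeries 4) j := by
  rw [pderiv_eq_derivation]
  refine (derivation_first_equation (derivation j) q a b d).trans ?_
  simp only [a, b, d, derivation_X]
  fin_cases j <;> simp

theorem pderiv_second_equation (p q : ℂ) (j : Fin 4) :
    pderiv j (equations p q 1) =
      (![-((2 : ℂ) • e), 0, (2 : ℂ) • d - (2 * p) • e,
        -((2 : ℂ) • a) - (2 * p) • d + (2 * p ^ 2) • e] : Fin 4 → ConvSeries 4) j := by
  rw [pderiv_eq_derivation]
  refine (derivation_second_equation (derivation j) p a d e).trans ?_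
  simp only [a, d, e, derivation_X]
  fin_cases j <;> simp

/-- The columns are solved triangularly: aE enters the formula for dE, and dF the one for aF. -/
theorem relations_of_jacobian {R T : Type*} [CommRing R] [Algebra ℂ R] [AddCommGroup T] [Module R T]
    [Module ℂ T] [IsScalarTower ℂ R T] {p q : ℂ} {a b d e : R} {E F : T}
    (ha : ((2 : ℂ) • a - (2 * q) • b) • E + -((2 : ℂ) • e) • F = 0)
    (hb : (-((2 * q) • a) + (2 * q ^ 2) • b - (2 : ℂ) • d) • E + (0 : R) • F = 0)
    (hd : -((2 : ℂ) • b) • E + ((2 : ℂ) • d - (2 * p) • e) • F = 0)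
    (he : (0 : R) • E + (-((2 : ℂ) • a) - (2 * p) • d + (2 * p ^ 2) • e) • F = 0) :
    a • E = q • b • E + e • F ∧ d • E = -q • e • F ∧
      d • F = b • E + p • e • F ∧ a • F = -p • b • E := by
  simp only [sub_smul, add_smul, neg_smul, smul_assoc, zero_smul] at ha hb hd he
  generalize a • E = aE, b • E = bE, d • E = dE, e • F = eF, d • F = dF, a • F = aF at *
  have haE : aE = q • bE + eF := by
    linear_combination (norm := module) (1 / 2 : ℂ) • ha
  have hdE : dE = -q • eF := by
    linear_combination (norm := module) -(1 / 2 : ℂ) • hb - q • haE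
  have hdF : dF = bE + p • eF := by
    linear_combination (norm := module) (1 / 2 : ℂ) • hd
  refine ⟨haE, hdE, hdF, ?_⟩
  linear_combination (norm := module) -(1 / 2 : ℂ) • he - p • hdF

theorem jacobian_relations {A : Type*} [CommRing A] [Algebra ℂ A] {T : Type*} [AddCommGroup T]
    [Module A T] [Module ℂ T] [IsScalarTower ℂ A T] (p q : ℂ) (π : ConvSeries 4 →ₐ[ℂ] A) {E F : T}
    (h : ∀ j, π (pderiv j (equations p q 0)) • E + π (pderiv j (equations p q 1)) • F = 0) :
    π a • E = q • π b • E + π e • F ∧ π d • E = -q • π e • F ∧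
      π d • F = π b • E + p • π e • F ∧ π a • F = -p • π b • E := by
  have ha := h 0
  have hb := h 1
  have hd := h 2
  have he := h 3
  simp only [pderiv_first_equation, pderiv_second_equation, Matrix.cons_val, map_sub, map_add,
    map_neg, map_zero, map_smul] at ha hb hd he
  exact relations_of_jacobian ha hb hd he

/-- Elements `E`, `F` of a module killed by the Jacobian relations of the germ have their multiples in
the complex span of seven explicit vectors. -/
theorem mem_span_of_annihilated {A : Type*} [CommRing A] [Algebra ℂ A] {T : Type*} [AddCommGroup T]
    [Module A T] [Module ℂ T] [IsScalarTower ℂ A T] {p q : ℂ} (h0 : p * q ≠ 0)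
    (h1 : p * q ≠ 1 / 4) (π : ConvSeries 4 →ₐ[ℂ] A) (hπ : Function.Surjective π)
    (hg : ∀ i, π (equations p q i) = 0) {E F : T}
    (h : ∀ j, π (pderiv j (equations p q 0)) • E + π (pderiv j (equations p q 1)) • F = 0)
    (f g : A) :
    f • E + g • F ∈ Submodule.span ℂ (Set.range
      ![E, π b • E, π e • E, F, π b • F, π (a * e) • F, π e • F]) := by
  obtain ⟨haE, hdE, hdF, haF⟩ := jacobian_relations p q π h
  have hg1 := hg 0
  have hg2 := hg 1
  simp only [equations, Matrix.cons_val, map_sub, map_add, map_neg, map_smul, map_mul, map_pow]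
    at hg1 hg2
  rw [map_mul]
  refine smul_add_smul_mem_span h0 h1 (fun f => ?_) haE hdE hdF haF ?_ ?_ ?_ f g
  · obtain ⟨f, rfl⟩ := hπ f
    refine ⟨MvPowerSeries.constantCoeff f.1, fun i => π (divX i f), ?_⟩
    conv_lhs => rw [eq_algebraMap_add_sum f]
    rw [map_add, map_sum, AlgHom.commutes]
    simp only [Fin.sum_univ_four, map_mul]
    rfl
  · rw [hg1, zero_smul]
  · rw [hg1, zero_smul]
  · rw [hg2, zero_smul]

end SliceGerm

/-! ### Linear independence through Taylor coefficients -/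

/-- The linear functionals that vanish on the Jacobian module, in terms of derivations. -/
theorem coefficients_eq_zero {R : Type*} [CommRing R] [Algebra ℂ R]
    (D : Fin 4 → Derivation ℂ R R) (ε : R →ₐ[ℂ] ℂ) (x : Fin 4 → R)
    (hD : ∀ i j, D i (x j) = if j = i then 1 else 0) (hε : ∀ i, ε (x i) = 0) {p q : ℂ}
    (hp : p ≠ 0) (hq : q ≠ 0) (f : Fin 4 → R) (h : Fin 2 → Fin 2 → R) (g : Fin 2 → R)
    (hg1 : g 0 = x 0 ^ 2 - (2 * q) • (x 0 * x 1) + (q ^ 2) • x 1 ^ 2 - (2 : ℂ) • (x 1 * x 2))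
    (hg2 : g 1 = -((2 : ℂ) • (x 0 * x 3)) + x 2 ^ 2 - (2 * p) • (x 2 * x 3) + (p ^ 2) • x 3 ^ 2)
    (c : Fin 7 → ℂ)
    (hV0 : c 0 • 1 + c 1 • x 1 + c 2 • x 3 =
      f 0 * ((2 : ℂ) • x 0 - (2 * q) • x 1)
        + f 1 * (-((2 * q) • x 0) + (2 * q ^ 2) • x 1 - (2 : ℂ) • x 2)
        + f 2 * (-((2 : ℂ) • x 1)) + h 0 0 * g 0 + h 0 1 * g 1)
    (hV1 : c 3 • 1 + c 4 • x 1 + c 5 • (x 0 * x 3) + c 6 • x 3 =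
      f 0 * (-((2 : ℂ) • x 3)) + f 2 * ((2 : ℂ) • x 2 - (2 * p) • x 3)
        + f 3 * (-((2 : ℂ) • x 0) - (2 * p) • x 2 + (2 * p ^ 2) • x 3)
        + h 1 0 * g 0 + h 1 1 * g 1) : c = 0 := by
  rw [hg1, hg2] at hV0 hV1
  have z0 := congrArg ε hV0
  have z1 := congrArg ε hV1
  have l0 (i) := congrArg (fun y => ε (D i y)) hV0
  have l1 (i) := congrArg (fun y => ε (D i y)) hV1
  have q0 (i j) := congrArg (fun y => ε (D j (D i y))) hV0
  have q1 (i j) := congrArg (fun y => ε (D j (D i y))) hV1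
  simp only [pow_two (x _), map_add, map_sub, map_neg, map_smul, Derivation.map_smul,
    Derivation.leibniz, smul_eq_mul, map_mul, hε, hD, map_zero, map_one, mul_zero, zero_mul, add_zero,
    zero_add, sub_zero, neg_zero,
    Derivation.map_one_eq_zero, apply_ite ε, apply_ite (D _), ite_self] at z0 z1 l0 l1 q0 q1
  -- Up to the overall sign, the weights are the coefficients of s in the quadratic monomials times
  -- E (`q0`) and F (`q1`). They are scaled by p³q⁴ to clear denominators and halved for squares,
  -- whose second derivative is 2. Since aeF = -ps, the result is p⁴q⁴ times `c 5`.
  have c5 : p ^ 4 * q ^ 4 * c 5 = 0 := by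
    linear_combination (norm := skip)
      -(((2 * p ^ 5 * q ^ 5 - p ^ 4 * q ^ 4) / 2) * q0 0 0
        + (2 * p ^ 5 * q ^ 4) * q0 0 1
        + (p ^ 4 * q ^ 5) * q0 0 2
        + (p ^ 2 * q ^ 4 * (3 * p * q - 1)) * q0 0 3
        + (-p ^ 4 * q ^ 2 * (1 - 2 * p * q) / 2) * q0 1 1
        + (-p ^ 4 * q ^ 4) * q0 1 2
        + (p ^ 3 * q ^ 4) * q0 1 3
        + (-p ^ 4 * q ^ 6) * q0 2 2
        + (p ^ 2 * q ^ 5 * (1 - 2 * p * q)) * q0 2 3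
        + (q ^ 4 * (-1 + 4 * p * q - p ^ 2 * q ^ 2)) * q0 3 3
        + (-p ^ 6 * q ^ 4) * q1 0 0
        + (p ^ 5 * q ^ 2 * (1 - 2 * p * q)) * q1 0 1
        + (p ^ 5 * q ^ 4) * q1 0 2
        + (-p ^ 4 * q ^ 4) * q1 0 3
        + (p ^ 4 * (-1 + 4 * p * q - p ^ 2 * q ^ 2)) * q1 1 1
        + (p ^ 4 * q ^ 2 * (3 * p * q - 1)) * q1 1 2
        + (p ^ 4 * q ^ 3) * q1 1 3
        + ((-p ^ 4 * q ^ 4 + 2 * p ^ 5 * q ^ 5) / 2) * q1 2 2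
        + (2 * p ^ 4 * q ^ 5) * q1 2 3
        + (-p ^ 2 * q ^ 4 * (1 - 2 * p * q) / 2) * q1 3 3)
    simp only [Fin.reduceEq, if_true, if_false]
    ring
  -- The weights read off the coefficient of bE in the Jacobian relations; those for `c6` read off
  -- the coefficient of eF.
  have c1 : c 1 = 0 := by
    linear_combination (norm := skip) l0 1 + q * l0 0 + l1 2 - p * l1 0
    simp only [Fin.reduceEq, if_true, if_false]
    ring
  have c2 : c 2 = 0 := by
    linear_combination (norm := skip) l0 3
    simp only [Fin.reduceEq, if_true, if_false]
    ring
  have c4 : c 4 = 0 := by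
    linear_combination (norm := skip) l1 1
    simp only [Fin.reduceEq, if_true, if_false]
    ring
  have c6 : c 6 = 0 := by
    linear_combination (norm := skip) l1 3 + l0 0 - q * l0 2 + p * l1 2
    simp only [Fin.reduceEq, if_true, if_false]
    ring
  have c5' : c 5 = 0 := by
    simpa [hp, hq] using c5
  funext i
  fin_cases i
  · simpa using z0
  · exact c1
  · exact c2
  · simpa using z1
  · exact c4
  · exact c5'
  · exact c6

/-! ### Spanning and independence in T¹ -/

namespace SliceGerm

open ConvSeries SpaceGerm

theorem mk_generators (p q : ℂ) (π : ConvSeries 4 →ₐ[ℂ] LocalRing (equations p q))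
    (hπ : ∀ x, π x = Ideal.Quotient.mk _ x) :
    (fun i => T1.mk (equations p q)
      ((![![1, 0], ![b, 0], ![e, 0], ![0, 1], ![0, b], ![0, a * e], ![0, e]] :
        Fin 7 → Fin 2 → ConvSeries 4) i)) =
    ![T1.mk (equations p q) ![1, 0],
      π b • T1.mk (equations p q) ![1, 0],
      π e • T1.mk (equations p q) ![1, 0],
      T1.mk (equations p q) ![0, 1],
      π b • T1.mk (equations p q) ![0, 1],
      π (a * e) • T1.mk (equations p q) ![0, 1],
      π e • T1.mk (equations p q) ![0, 1]] := by
  simp only [hπ]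
  funext i
  fin_cases i
  · rfl
  · exact T1.mk_left _ b
  · exact T1.mk_left _ e
  · rfl
  · exact T1.mk_right _ b
  · exact T1.mk_right _ (a * e)
  · exact T1.mk_right _ e

theorem span_T1 {p q : ℂ} (h0 : p * q ≠ 0) (h1 : p * q ≠ 1 / 4) (x : T1 (equations p q)) :
    x ∈ Submodule.span ℂ (Set.range fun i => T1.mk (equations p q)
      ((![![1, 0], ![b, 0], ![e, 0], ![0, 1], ![0, b], ![0, a * e], ![0, e]] :
        Fin 7 → Fin 2 → ConvSeries 4) i)) := by
  obtain ⟨π, hπ⟩ : ∃ π : ConvSeries 4 →ₐ[ℂ] LocalRing (equations p q),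
      ∀ x, π x = Ideal.Quotient.mk _ x := ⟨Ideal.Quotient.mkₐ ℂ _, fun _ => rfl⟩
  have hsurj : Function.Surjective π := fun y => by
    obtain ⟨x, rfl⟩ := Ideal.Quotient.mk_surjective y
    exact ⟨x, hπ x⟩
  have hg (i) : π (equations p q i) = 0 := by
    rw [hπ]
    exact Ideal.Quotient.eq_zero_iff_mem.2 (Ideal.subset_span (Set.mem_range_self i))
  have hJ := T1.jacobian_relation (equations p q)
  obtain ⟨v, rfl⟩ := T1.mk_surjective _ x
  rw [mk_generators p q π hπ, T1.mk_eq _ v]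
  simp only [← hπ] at hJ ⊢
  generalize T1.mk (equations p q) ![1, 0] = E at *
  generalize T1.mk (equations p q) ![0, 1] = F at *
  have key := mem_span_of_annihilated (A := LocalRing (equations p q)) (T := T1 (equations p q))
    h0 h1 π hsurj hg hJ (π (v 0)) (π (v 1))
  exact key

theorem linearIndependent_T1 {p q : ℂ} (h0 : p * q ≠ 0) :
    LinearIndependent ℂ fun i => T1.mk (equations p q)
      ((![![1, 0], ![b, 0], ![e, 0], ![0, 1], ![0, b], ![0, a * e], ![0, e]] :
        Fin 7 → Fin 2 → ConvSeries 4) i) := by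
  rw [Fintype.linearIndependent_iff]
  intro c hc
  set v : Fin 7 → Fin 2 → ConvSeries 4 :=
    ![![1, 0], ![b, 0], ![e, 0], ![0, 1], ![0, b], ![0, a * e], ![0, e]] with hv
  have hz : T1.mk (equations p q) (∑ i, c i • v i) = 0 := by
    rw [← hc]
    exact (map_sum (T1.mkₗ (equations p q)) _ _).trans
      (Finset.sum_congr rfl fun i _ => (T1.mkₗ (equations p q)).map_smul _ _)
  obtain ⟨f, h, hf⟩ := T1.mk_eq_zero_iff.1 hz
  have hf0 := hf 0
  have hf1 := hf 1
  simp only [Finset.sum_apply, Pi.smul_apply, Fin.sum_univ_succ, Fin.sum_univ_zero,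
    pderiv_first_equation, pderiv_second_equation, hv] at hf0 hf1
  refine congrFun (coefficients_eq_zero derivation eval₀ X derivation_X eval₀_X
    (left_ne_zero_of_mul h0) (right_ne_zero_of_mul h0) f h (equations p q) rfl rfl c ?_ ?_)
  · refine Eq.trans ?_ (hf0.trans ?_)
    · simp [b, e, add_assoc]
    · simp [a, b, d]
      ring
  · refine Eq.trans ?_ (hf1.trans ?_)
    · simp [a, b, e, add_assoc]
    · simp [a, d, e]
      ring

end SliceGerm

open SpaceGerm SliceGerm in
theorem lemma3p1 (p q : ℂ) (h0 : p * q ≠ 0) (h1 : p * q ≠ 1 / 4) :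
    Module.finrank ℂ (T1 (equations p q)) = 7 ∧
      ∃ B : Module.Basis (Fin 7) ℂ (T1 (equations p q)),
        ∀ i, B i = T1.mk (equations p q)
          ((![![1, 0], ![b, 0], ![e, 0], ![0, 1], ![0, b], ![0, a * e], ![0, e]] :
            Fin 7 → Fin 2 → ConvSeries 4) i) := by
  let B := Module.Basis.mk (linearIndependent_T1 h0) fun x _ => span_T1 h0 h1 x
  refine ⟨by rw [Module.finrank_eq_card_basis B, Fintype.card_fin], B, fun i => ?_⟩
  exact Module.Basis.mk_apply _ _ i
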